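/- Let $n\ge 2$ be even and let $n$ agents $1,\dots,n$ (indices modulo $n$) have reduced attitudes $\Gamma_i\in\mathcal S^2=\{x\in\mathbb R^3:\|x\|=1\}$. Let the neighbor sets be those of a ring, either undirected, $\mathcal N_i=\{i-1,i+1\}$ for all $i$ (one neighbor if $n=2$), or directed, $\mathcal N_i=\{i+1\}$ for all $i$. Consider the kinematics $\dot\Gamma_i=\omega_i\times\Gamma_i$ on $(\mathcal S^2)^n$ with the control law $\omega_i=-\sum_{j\in\mathcal N_i}\Gamma_i\times\Gamma_j$, $i=1,\dots,n$. Let $d(x,y)=\arccos(x^Ty)$ be the geodesic distance on $\mathcal S^2$. For $\mathbf\Gamma=(\Gamma_1,\dots,\Gamma_n)$ and $\mathcal M\subset(\mathcal S^2)^n$ put $d_{\mathcal M}(\mathbf\Gamma)=\inf_{\bar{\mathbf\Gamma}\in\mathcal M}\max_i d(\Gamma_i,\bar\Gamma_i)$ and $W(\mathbf\Gamma)=\min_i d(\Gamma_i,\Gamma_{i+1})$. Let $$\mathcal M_e=\{\mathbf\Gamma\in(\mathcal S^2)^n:\ \exists\, v\in\mathcal S^2\ \forall i,\ \Gamma_i=(-1)^{i-1}v\}.$$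 Then $\mathcal M_e$ is positively invariant and asymptotically stable for this closed-loop system, and its region of attraction contains $$\Omega_e=\{\mathbf\Gamma\in(\mathcal S^2)^n:\ W(\mathbf\Gamma)>\pi-2\pi/n\}.$$ Here the region of attraction of $\mathcal M_e$ is the set of initial states from which a solution exists for all $t\ge 0$ and every such solution satisfies $d_{\mathcal M_e}(\mathbf\Gamma(t))\to 0$ as $t\to\infty$. Asymptotically stable means: (stability) for every $\varepsilon>0$ there is $\delta>0$ such that every solution on $[0,\infty)$ with $d_{\mathcal M_e}(\mathbf\Gamma(0))<\delta$ satisfies $d_{\mathcal M_e}(\mathbf\Gamma(t))<\varepsilon$ for all $t\ge0$; and (attractivity) for some $\delta>0$ all states with $d_{\mathcal M_e}<\delta$ lie in the region of attraction. -/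

import Mathlib

namespace ReducedAttitude

noncomputable section

/-- Euclidean 3-space. -/
abbrev E3 : Type := EuclideanSpace ℝ (Fin 3)

/-- The unit sphere of Euclidean 3-space, the space of reduced attitudes. -/
abbrev S2 : Type := Metric.sphere (0 : E3) 1

/-- The state space: one reduced attitude per agent. The agents `1, …, n` are indexed by
`0, …, n - 1`, and addition on `Fin n` is addition modulo `n`. -/
abbrev State (n : ℕ) : Type := Fin n → S2

/-- The cross product `x × y`; as a function of `y` it is the hat operator of `x`. -/
def cross (x y : E3) : E3 := WithLp.toLp 2 (crossProduct x.ofLp y.ofLp)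

/-- The geodesic distance on the sphere. -/
def geodDist (x y : S2) : ℝ := Real.arccos (inner ℝ (x : E3) (y : E3))

/-- The maximum of the geodesic distances of the components of two states. -/
def stateDist {n : ℕ} (Γ Γ' : State n) : ℝ := ⨆ i, geodDist (Γ i) (Γ' i)

/-- The distance from a state to a set of states. -/
def distToSet {n : ℕ} (M : Set (State n)) (Γ : State n) : ℝ := sInf (stateDist Γ '' M)

/-- The minimal geodesic distance between agents that are consecutive in the ring. -/
def minNeighborDist {n : ℕ} [NeZero n] (Γ : State n) : ℝ := ⨅ i, geodDist (Γ i) (Γ (i + 1))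

/-- The set of antipodal formations; the exponent `i - 1` of one-based indexing becomes `i`. -/
def antipodalSet (n : ℕ) : Set (State n) :=
  {Γ | ∃ v : S2, ∀ i : Fin n, (Γ i : E3) = (-1 : ℝ) ^ (i : ℕ) • (v : E3)}

open Classical in
/-- The neighbors of agent `i` are the agents `j` with an edge from `j` to `i`. -/
def neighbors {n : ℕ} (G : Digraph (Fin n)) (i : Fin n) : Finset (Fin n) :=
  Finset.univ.filter fun j => G.Adj j i

/-- The undirected ring: the neighbors of `i` are `i - 1` and `i + 1`, which coincide if
there are two agents. -/
def IsUndirectedRing {n : ℕ} [NeZero n] (G : Digraph (Fin n)) : Prop :=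
  ∀ i, neighbors G i = {i - 1, i + 1}

/-- The directed ring: the only neighbor of `i` is `i + 1`. -/
def IsDirectedRing {n : ℕ} [NeZero n] (G : Digraph (Fin n)) : Prop :=
  ∀ i, neighbors G i = {i + 1}

/-- The reversed-sign consensus law for the angular velocity of agent `i`. -/
def control {n : ℕ} (G : Digraph (Fin n)) (Γ : State n) (i : Fin n) : E3 :=
  -∑ j ∈ neighbors G i, cross (Γ i) (Γ j)

/-- `Γ` solves on `[0, ∞)` the reduced attitude kinematics in closed loop with the control law
(with the one-sided derivative at time zero). Only the values of `Γ` at nonnegative times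
matter. -/
def IsTrajectory {n : ℕ} (G : Digraph (Fin n)) (Γ : ℝ → State n) : Prop :=
  ∀ t, 0 ≤ t → ∀ i,
    HasDerivWithinAt (fun s => (Γ s i : E3)) (cross (control G (Γ t) i) (Γ t i)) (Set.Ici 0) t

/-- Trajectories that start in `M` remain in `M`. -/
def IsPositivelyInvariant {n : ℕ} (G : Digraph (Fin n)) (M : Set (State n)) : Prop :=
  ∀ Γ, IsTrajectory G Γ → Γ 0 ∈ M → ∀ t, 0 ≤ t → Γ t ∈ M

/-- Lyapunov stability of a set. -/
def IsStableSet {n : ℕ} (G : Digraph (Fin n)) (M : Set (State n)) : Prop :=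
  ∀ ε > 0, ∃ δ > 0, ∀ Γ, IsTrajectory G Γ → distToSet M (Γ 0) < δ →
    ∀ t, 0 ≤ t → distToSet M (Γ t) < ε

/-- The initial states from which the closed-loop system has a trajectory for all positive
times, and every such trajectory converges to `M`. -/
def regionOfAttraction {n : ℕ} (G : Digraph (Fin n)) (M : Set (State n)) : Set (State n) :=
  {Γ₀ | (∃ Γ, IsTrajectory G Γ ∧ Γ 0 = Γ₀) ∧
    ∀ Γ, IsTrajectory G Γ → Γ 0 = Γ₀ →
      Filter.Tendsto (fun t => distToSet M (Γ t)) Filter.atTop (nhds 0)}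

/-- Asymptotic stability of a set: it is stable, and it attracts all states near it. -/
def IsAsymptoticallyStableSet {n : ℕ} (G : Digraph (Fin n)) (M : Set (State n)) : Prop :=
  IsStableSet G M ∧ ∃ δ > 0, {Γ₀ | distToSet M Γ₀ < δ} ⊆ regionOfAttraction G M

end

end ReducedAttitude

open ReducedAttitude

open Set Filter Topology NNReal

namespace ReducedAttitude

/-! Put `x i = (-1)^i Γ i`. As `n` is even, the signs alternate all around the ring, so repulsion
between neighbors becomes attraction and `antipodalSet` becomes consensus
(`isConsensusFlow_alternate`).

Two facts about this consensus flow carry the proof; both use that the ring is balanced. Caps `⟪v, x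
i⟫ ≥ m` with `m ≥ 0` are invariant (`le_inner_of_le_inner_zero`), which yields stability and, for `m
= 1`, invariance. If moreover `m > 0`, the bounded function `∑ ⟪v, x i⟫` grows at least at the rate
`m ∑ (1 - ⟪x i, x j⟫)`, summed over the edges; a Barbalat argument forces neighbors to align
(`tendsto_inner_neighbor`), hence all agents, since the ring is connected.

It remains to find an open hemisphere. On `Ω_e` the `x i` form a closed polygon with sides shorter
than `2π/n`, thus of length less than `2π`, and `exists_inner_pos_of_angle_lt` applies. Global
existence comes from a bounded `C¹` extension of the field that preserves norms. -/

/-! ### Differential equations and inequalities on `[0, ∞)` -/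

/-- A bounded `C¹` vector field on a finite-dimensional space has a forward integral curve that is
defined for all nonnegative times. -/
theorem exists_forward_solution {E : Type*} [NormedAddCommGroup E] [NormedSpace ℝ E]
    [FiniteDimensional ℝ E] {F : E → E} (hF : ContDiff ℝ 1 F) {L : ℝ≥0} (hL : ∀ x, ‖F x‖ ≤ L)
    (x₀ : E) :
    ∃ α : ℝ → E, α 0 = x₀ ∧ ∀ t, 0 ≤ t → HasDerivWithinAt α (F (α t)) (Ici 0) t := by
  have : CompleteSpace E := FiniteDimensional.complete ℝ E
  have : ProperSpace E := FiniteDimensional.proper ℝ E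
  have hlip : ∀ s : Set E, IsCompact s → ∃ K, LipschitzOnWith K F s := fun s hs =>
    hF.locallyLipschitz.locallyLipschitzOn.exists_lipschitzOnWith_of_compact hs
  have hex : ∀ T : ℝ, 0 ≤ T → ∃ α : ℝ → E, α 0 = x₀ ∧
      ∀ t ∈ Icc 0 T, HasDerivWithinAt α (F (α t)) (Icc 0 T) t := by
    intro T hT
    -- At speed at most `L` a solution stays in the ball of radius `L T` up to time `T`, so one
    -- Picard–Lindelöf step covers `[0, T]`.
    obtain ⟨K, hK⟩ := hlip _ (isCompact_closedBall x₀ ((L * T.toNNReal : ℝ≥0) : ℝ))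
    have hpl : IsPicardLindelof (fun _ => F) (⟨0, le_rfl, hT⟩ : Icc 0 T) x₀ (L * T.toNNReal) 0 L K :=
      IsPicardLindelof.of_time_independent (fun x _ => hL x) hK (by simp [hT])
    exact hpl.exists_eq_forall_mem_Icc_hasDerivWithinAt₀
  choose! β hβ0 hβ using hex
  have hcont : ∀ T, 0 ≤ T → ContinuousOn (β T) (Icc 0 T) := fun T hT t ht =>
    (hβ T hT t ht).continuousWithinAt
  have hright : ∀ S T, S ≤ T → 0 ≤ S → ∀ t ∈ Ico 0 S,
      HasDerivWithinAt (β T) (F (β T t)) (Ici t) t := by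
    intro S T hST hS t ht
    refine (hβ T (hS.trans hST) t ⟨ht.1, ht.2.le.trans hST⟩).mono_of_mem_nhdsWithin ?_
    exact mem_of_superset (Icc_mem_nhdsGE (ht.2.trans_le hST)) (Icc_subset_Icc_left ht.1)
  have huniq : ∀ S T, 0 ≤ S → S ≤ T → EqOn (β S) (β T) (Icc 0 S) := by
    intro S T hS hST
    have hsub : Icc 0 S ⊆ Icc 0 T := Icc_subset_Icc_right hST
    obtain ⟨K, hK⟩ := hlip (β S '' Icc 0 S ∪ β T '' Icc 0 S)
      ((isCompact_Icc.image_of_continuousOn (hcont S hS)).union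
        (isCompact_Icc.image_of_continuousOn ((hcont T (hS.trans hST)).mono hsub)))
    exact ODE_solution_unique_of_mem_Icc_right (v := fun _ => F) (fun _ _ => hK) (hcont S hS)
      (hright S S le_rfl hS) (fun t ht => Or.inl (mem_image_of_mem _ (Ico_subset_Icc_self ht)))
      ((hcont T (hS.trans hST)).mono hsub) (hright S T hST hS)
      (fun t ht => Or.inr (mem_image_of_mem _ (Ico_subset_Icc_self ht)))
      (by rw [hβ0 S hS, hβ0 T (hS.trans hST)])
  -- For `s < t + 1` the diagonal value equals `β (t + 2) s`, so near `t` it follows a single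
  -- solution.
  refine ⟨fun t => β (t + 1) t, hβ0 _ (by norm_num), fun t ht => ?_⟩
  have heq : ∀ s, 0 ≤ s → s < t + 1 → β (s + 1) s = β (t + 2) s := fun s hs hst =>
    huniq (s + 1) (t + 2) (by linarith) (by linarith) ⟨hs, by linarith⟩
  have hd := hβ (t + 2) (by linarith) t ⟨ht, by linarith⟩
  simp only [heq t ht (by linarith)]
  refine (hd.mono_of_mem_nhdsWithin ?_).congr_of_eventuallyEq ?_ (heq t ht (by linarith))
  · rw [mem_nhdsWithin]
    exact ⟨Iio (t + 2), isOpen_Iio, by simp, fun s hs => ⟨hs.2, le_of_lt hs.1⟩⟩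
  · rw [EventuallyEq, eventually_nhdsWithin_iff]
    filter_upwards [Iio_mem_nhds (show t < t + 1 by linarith)] with s hs hs0 using heq s hs0 hs

/-- A function with a nonnegative forward derivative is monotone on `[0, ∞)`. -/
theorem monotoneOn_Ici_of_hasDerivWithinAt {f f' : ℝ → ℝ}
    (hf : ∀ t, 0 ≤ t → HasDerivWithinAt f (f' t) (Ici 0) t) (hf' : ∀ t, 0 ≤ t → 0 ≤ f' t) :
    MonotoneOn f (Ici 0) := by
  refine monotoneOn_of_hasDerivWithinAt_nonneg (f' := f') (convex_Ici 0)
    (fun t ht => (hf t ht).continuousWithinAt) (fun t ht => ?_) (fun t ht => ?_)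
  · rw [interior_Ici] at ht ⊢
    exact (hf t (le_of_lt ht)).mono Ioi_subset_Ici_self
  · rw [interior_Ici] at ht
    exact hf' t (le_of_lt ht)

/-- A nonnegative function that starts at zero and satisfies `f' ≤ C f` vanishes. -/
theorem eq_zero_of_hasDerivWithinAt_le_mul {f f' : ℝ → ℝ} {C : ℝ}
    (hf : ∀ t, 0 ≤ t → HasDerivWithinAt f (f' t) (Ici 0) t)
    (hf' : ∀ t, 0 ≤ t → f' t ≤ C * f t) (h0 : f 0 = 0) (hnonneg : ∀ t, 0 ≤ f t)
    {t : ℝ} (ht : 0 ≤ t) : f t = 0 := by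
  -- Integrating factor: `f s * exp (-C s)` does not increase.
  have hmono : MonotoneOn (fun s => -(f s * Real.exp (-C * s))) (Ici 0) := by
    refine monotoneOn_Ici_of_hasDerivWithinAt
      (f' := fun s => -(f' s * Real.exp (-C * s) + f s * (Real.exp (-C * s) * -C))) ?_ ?_
    · intro s hs
      have he : HasDerivAt (fun s => Real.exp (-C * s)) (Real.exp (-C * s) * -C) s := by
        simpa using ((hasDerivAt_id s).const_mul (-C)).exp
      exact ((hf s hs).mul he.hasDerivWithinAt).neg
    · intro s hs
      have := mul_nonneg (sub_nonneg.2 (hf' s hs)) (Real.exp_pos (-C * s)).le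
      linarith
  have h := hmono (mem_Ici.2 le_rfl) ht ht
  simp only [h0, zero_mul, neg_zero, Left.nonneg_neg_iff] at h
  exact le_antisymm (nonpos_of_mul_nonpos_left h (Real.exp_pos _)) (hnonneg t)

/-- If a bounded function grows at least at the rate `m D`, where `m > 0` and `D` is nonnegative
with a bounded derivative, then `D` tends to zero. -/
theorem tendsto_zero_of_mul_le_deriv {S S' D D' : ℝ → ℝ} {m B C : ℝ} (hm : 0 < m)
    (hS : ∀ t, 0 ≤ t → HasDerivWithinAt S (S' t) (Ici 0) t)
    (hD : ∀ t, 0 ≤ t → HasDerivWithinAt D (D' t) (Ici 0) t)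
    (hSD : ∀ t, 0 ≤ t → m * D t ≤ S' t) (hD0 : ∀ t, 0 ≤ t → 0 ≤ D t)
    (hB : ∀ t, 0 ≤ t → S t ≤ B) (hC : ∀ t, 0 ≤ t → -C ≤ D' t) :
    Tendsto D atTop (𝓝 0) := by
  wlog hCpos : 0 < C generalizing C
  · exact this (C := |C| + 1) (fun t ht => by have := hC t ht; have := le_abs_self C; linarith)
      (by positivity)
  have hSmono : MonotoneOn S (Ici 0) := monotoneOn_Ici_of_hasDerivWithinAt hS fun t ht =>
    (mul_nonneg hm.le (hD0 t ht)).trans (hSD t ht)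
  -- The potential after a delay `τ` dominates a quadratic polynomial in `τ`.
  have key : ∀ t, 0 ≤ t → ∀ τ, 0 ≤ τ → S t + m * (D t * τ - C * τ ^ 2 / 2) ≤ S (t + τ) := by
    intro t ht τ hτ
    have hDmono : MonotoneOn (fun s => D s + C * s) (Ici 0) :=
      monotoneOn_Ici_of_hasDerivWithinAt (f' := fun s => D' s + C)
        (fun s hs => by
          have h1 : HasDerivAt (fun s : ℝ => C * s) C s := by
            simpa using (hasDerivAt_id s).const_mul C
          exact (hD s hs).add h1.hasDerivWithinAt)
        fun s hs => by have := hC s hs; linarith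
    have hshift : ∀ u, 0 ≤ u → HasDerivWithinAt (fun u => S (t + u)) (S' (t + u)) (Ici 0) u := by
      intro u hu
      have h1 : HasDerivWithinAt (fun u : ℝ => t + u) 1 (Ici 0) u :=
        ((hasDerivAt_id u).const_add t).hasDerivWithinAt
      have := (hS (t + u) (by positivity)).scomp u h1 (fun v hv => by
        simp only [mem_Ici] at hv ⊢; positivity)
      rw [one_smul] at this
      exact this
    have hmono : MonotoneOn (fun u => S (t + u) - m * (D t * u - C * u ^ 2 / 2)) (Ici 0) := by
      refine monotoneOn_Ici_of_hasDerivWithinAt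
        (f' := fun u => S' (t + u) - m * (D t - C * u)) (fun u hu => ?_) fun u hu => ?_
      · have h2 : HasDerivAt (fun u => m * (D t * u - C * u ^ 2 / 2)) (m * (D t - C * u)) u := by
          have h21 : HasDerivAt (fun u : ℝ => D t * u) (D t) u := by
            simpa using (hasDerivAt_id u).const_mul (D t)
          have h22 : HasDerivAt (fun u : ℝ => C * u ^ 2 / 2) (C * u) u := by
            convert! ((hasDerivAt_pow 2 u).const_mul C).div_const 2 using 1
            norm_num
            ring
          exact (h21.sub h22).const_mul m
        exact (hshift u hu).sub h2.hasDerivWithinAt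
      · have h3 := hDmono (mem_Ici.2 ht) (mem_Ici.2 (add_nonneg ht hu))
          (le_add_of_nonneg_right hu)
        have h4 := hSD (t + u) (add_nonneg ht hu)
        have h5 : m * (D t - C * u) ≤ m * D (t + u) :=
          mul_le_mul_of_nonneg_left (by simp only at h3; linarith) hm.le
        linarith
    have := hmono (mem_Ici.2 le_rfl) (mem_Ici.2 hτ) hτ
    simp at this
    linarith
  obtain ⟨l, hl⟩ : ∃ l, Tendsto S atTop (𝓝 l) := by
    have hmono : Monotone fun t => S (max t 0) := fun s t hst =>
      hSmono (mem_Ici.2 (le_max_right _ _)) (mem_Ici.2 (le_max_right _ _)) (max_le_max_right 0 hst)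
    have hbdd : BddAbove (range fun t => S (max t 0)) :=
      ⟨B, by rintro _ ⟨t, rfl⟩; exact hB _ (le_max_right _ _)⟩
    refine ⟨_, (tendsto_atTop_ciSup hmono hbdd).congr' ?_⟩
    filter_upwards [eventually_ge_atTop 0] with t ht
    rw [max_eq_left ht]
  rw [Metric.tendsto_nhds]
  intro ε hε
  have hdiff : Tendsto (fun t => S (t + ε / C) - S t) atTop (𝓝 0) := by
    have := (hl.comp (tendsto_atTop_add_const_right atTop (ε / C) tendsto_id)).sub hl
    simpa using this
  -- If `D t ≥ ε`, the delay `ε / C`, which maximizes `ε τ - C τ² / 2`, makes `S` gain at least this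
  -- amount.
  have hpos : 0 < m * (ε ^ 2 / (2 * C)) := by positivity
  filter_upwards [hdiff.eventually_lt_const hpos, eventually_ge_atTop 0] with t h1 ht
  rw [Real.dist_eq, sub_zero, abs_of_nonneg (hD0 t ht)]
  by_contra! hge
  have h2 := key t ht (ε / C) (by positivity)
  have h3 : m * (ε ^ 2 / (2 * C)) ≤ m * (D t * (ε / C) - C * (ε / C) ^ 2 / 2) := by
    refine mul_le_mul_of_nonneg_left ?_ hm.le
    have h4 : ε * (ε / C) ≤ D t * (ε / C) := mul_le_mul_of_nonneg_right hge (by positivity)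
    have h5 : ε * (ε / C) - C * (ε / C) ^ 2 / 2 = ε ^ 2 / (2 * C) := by field_simp; ring
    linarith
  linarith

/-- The square of the negative part is differentiable. -/
theorem hasDerivAt_min_zero_sq (x : ℝ) :
    HasDerivAt (fun y : ℝ => min y 0 ^ 2) (2 * min x 0) x := by
  rcases lt_trichotomy x 0 with hx | rfl | hx
  · rw [min_eq_left hx.le]
    have h : HasDerivAt (fun y : ℝ => y ^ 2) (2 * x) x := by simpa using hasDerivAt_pow 2 x
    refine h.congr_of_eventuallyEq ?_
    filter_upwards [Iio_mem_nhds hx] with y hy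
    rw [min_eq_left (le_of_lt hy)]
  · rw [hasDerivAt_iff_isLittleO]
    have h : (fun y : ℝ => y ^ 2) =o[𝓝 0] fun y => y := by
      simpa using Asymptotics.isLittleO_pow_pow (𝕜 := ℝ) (m := 1) (n := 2) (by norm_num)
    refine (Asymptotics.IsBigO.of_bound 1 (Eventually.of_forall fun y => ?_)).trans_isLittleO
      (h.congr_right fun y => (sub_zero y).symm)
    rcases le_total y 0 with hy | hy <;> simp [hy]
  · rw [min_eq_right hx.le, mul_zero]
    refine (hasDerivAt_const x (0 : ℝ)).congr_of_eventuallyEq ?_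
    filter_upwards [Ioi_mem_nhds hx] with y hy
    rw [min_eq_right (le_of_lt hy)]
    simp

/-! ### Consensus flows on unit spheres over balanced digraphs -/

section Consensus

variable {ι E : Type*} [NormedAddCommGroup E] [InnerProductSpace ℝ E]

/-- The neighbor sets of a digraph in which every node has as many out-neighbors as
in-neighbors. -/
def IsBalanced [Fintype ι] (N : ι → Finset ι) : Prop :=
  ∀ f : ι → ℝ, ∑ i, ∑ j ∈ N i, f j = ∑ i, ∑ _j ∈ N i, f i

/-- The curve `x` in the product of unit spheres solves the consensus system: every component
moves along the sum of the tangential parts of its neighbors. -/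
structure IsConsensusFlow (N : ι → Finset ι) (x : ℝ → ι → E) : Prop where
  norm_eq_one : ∀ t i, ‖x t i‖ = 1
  hasDerivWithinAt : ∀ t, 0 ≤ t → ∀ i, HasDerivWithinAt (fun s => x s i)
    (∑ j ∈ N i, (x t j - inner ℝ (x t i) (x t j) • x t i)) (Ici 0) t

namespace IsConsensusFlow

variable {N : ι → Finset ι} {x : ℝ → ι → E}

theorem inner_le_one (hx : IsConsensusFlow N x) (t : ℝ) (i j : ι) :
    inner ℝ (x t i) (x t j) ≤ 1 := by
  simpa [hx.norm_eq_one] using real_inner_le_norm (x t i) (x t j)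

theorem abs_inner_le_one (hx : IsConsensusFlow N x) (t : ℝ) (i j : ι) :
    |inner ℝ (x t i) (x t j)| ≤ 1 := by
  simpa [hx.norm_eq_one] using abs_real_inner_le_norm (x t i) (x t j)

theorem hasDerivWithinAt_inner (hx : IsConsensusFlow N x) (v : E) {t : ℝ} (ht : 0 ≤ t) (i : ι) :
    HasDerivWithinAt (fun s => inner ℝ v (x s i))
      (∑ j ∈ N i, (inner ℝ v (x t j) - inner ℝ (x t i) (x t j) * inner ℝ v (x t i)))
      (Ici 0) t := by
  have h := (hasDerivWithinAt_const t (Ici (0 : ℝ)) v).inner ℝ (hx.hasDerivWithinAt t ht i)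
  simpa [inner_sum, inner_sub_right, inner_smul_right] using h

variable [Fintype ι]

theorem norm_velocity_le (hx : IsConsensusFlow N x) (t : ℝ) (i : ι) :
    ‖∑ j ∈ N i, (x t j - inner ℝ (x t i) (x t j) • x t i)‖ ≤ Fintype.card ι * 2 := by
  calc _ ≤ ∑ _j ∈ N i, (2 : ℝ) := by
        refine norm_sum_le_of_le _ fun j _ => (norm_sub_le _ _).trans ?_
        rw [norm_smul, hx.norm_eq_one, hx.norm_eq_one, mul_one, Real.norm_eq_abs]
        linarith [hx.abs_inner_le_one t i j]
    _ = (N i).card * 2 := by simp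
    _ ≤ _ := by gcongr; exact Finset.card_le_univ _

/-- A spherical cap contained in a closed hemisphere is positively invariant. -/
theorem le_inner_of_le_inner_zero (hx : IsConsensusFlow N x) (hN : IsBalanced N) {v : E} {m : ℝ}
    (hm : 0 ≤ m) (h0 : ∀ i, m ≤ inner ℝ v (x 0 i)) {t : ℝ} (ht : 0 ≤ t) (i : ι) :
    m ≤ inner ℝ v (x t i) := by
  -- The sum of the squared deficits below height `m` is differentiable, and a Grönwall estimate
  -- keeps it at zero.
  set g : ℝ → ι → ℝ := fun t i => min (inner ℝ v (x t i) - m) 0 with hg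
  have hderiv : ∀ t, 0 ≤ t → HasDerivWithinAt (fun s => ∑ i, g s i ^ 2)
      (∑ i, 2 * g t i * ∑ j ∈ N i,
        (inner ℝ v (x t j) - inner ℝ (x t i) (x t j) * inner ℝ v (x t i))) (Ici 0) t := by
    intro t ht
    refine HasDerivWithinAt.fun_sum fun i _ => ?_
    exact (hasDerivAt_min_zero_sq (inner ℝ v (x t i) - m)).comp_hasDerivWithinAt t
      ((hx.hasDerivWithinAt_inner v ht i).sub_const m)
  have hbound : ∀ t, 0 ≤ t → ∑ i, 2 * g t i * ∑ j ∈ N i,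
      (inner ℝ v (x t j) - inner ℝ (x t i) (x t j) * inner ℝ v (x t i)) ≤
      4 * Fintype.card ι * ∑ i, g t i ^ 2 := by
    intro t ht
    have hterm : ∀ i j, 2 * g t i *
        (inner ℝ v (x t j) - inner ℝ (x t i) (x t j) * inner ℝ v (x t i)) ≤
        3 * g t i ^ 2 + g t j ^ 2 := by
      intro i j
      have h1 := abs_le.1 (hx.abs_inner_le_one t i j)
      have hi : g t i ≤ 0 := min_le_right _ _
      have hj : g t j ≤ inner ℝ v (x t j) - m := min_le_left _ _
      have hii : g t i * (inner ℝ v (x t i) - m) = g t i ^ 2 := by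
        rcases le_total (inner ℝ v (x t i) - m) 0 with h | h
        · simp [hg, h, sq]
        · simp [hg, h]
      generalize inner ℝ (x t i) (x t j) = c at *
      generalize inner ℝ v (x t i) = a at *
      generalize inner ℝ v (x t j) = b at *
      generalize g t i = p at *
      generalize g t j = q at *
      have h2 : p * (b - m) ≤ p * q := mul_le_mul_of_nonpos_left hj hi
      -- Here `p * a = p² + p * m`, and `p * m ≤ 0` because `m ≥ 0`.
      have h3 : p * a ≤ p ^ 2 := by nlinarith [mul_nonneg hm (neg_nonneg.2 hi)]
      have h4 : (1 - c) * (p * a) ≤ (1 - c) * p ^ 2 :=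
        mul_le_mul_of_nonneg_left h3 (by linarith [h1.2])
      have h5 : (1 - c) * p ^ 2 ≤ 2 * p ^ 2 :=
        mul_le_mul_of_nonneg_right (by linarith [h1.1]) (sq_nonneg p)
      nlinarith [sq_nonneg (p - q)]
    calc _ = ∑ i, ∑ j ∈ N i, 2 * g t i *
          (inner ℝ v (x t j) - inner ℝ (x t i) (x t j) * inner ℝ v (x t i)) := by
          simp_rw [Finset.mul_sum]
      _ ≤ ∑ i, ∑ j ∈ N i, (3 * g t i ^ 2 + g t j ^ 2) :=
          Finset.sum_le_sum fun i _ => Finset.sum_le_sum fun j _ => hterm i j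
      _ = ∑ i, ∑ _j ∈ N i, 4 * g t i ^ 2 := by
          simp_rw [Finset.sum_add_distrib]
          rw [hN fun j => g t j ^ 2]
          simp_rw [← Finset.sum_add_distrib]
          refine Finset.sum_congr rfl fun i _ => Finset.sum_congr rfl fun j _ => by ring
      _ ≤ ∑ i, 4 * Fintype.card ι * g t i ^ 2 := by
          refine Finset.sum_le_sum fun i _ => ?_
          rw [Finset.sum_const, nsmul_eq_mul]
          have : ((N i).card : ℝ) ≤ Fintype.card ι := by exact_mod_cast Finset.card_le_univ _
          nlinarith [sq_nonneg (g t i)]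
      _ = _ := by rw [Finset.mul_sum]
  have hzero := eq_zero_of_hasDerivWithinAt_le_mul hderiv hbound
    (Finset.sum_eq_zero fun i _ => by simp [hg, h0 i])
    (fun t => Finset.sum_nonneg fun i _ => sq_nonneg _) ht
  have hi := (Finset.sum_eq_zero_iff_of_nonneg fun i _ => sq_nonneg (g t i)).1 hzero i
    (Finset.mem_univ i)
  have hi' := min_eq_right_iff.1 (pow_eq_zero_iff two_ne_zero |>.1 hi)
  linarith

/-- A consensus flow on a balanced digraph that starts in an open hemisphere aligns
neighbors. -/
theorem tendsto_inner_neighbor (hx : IsConsensusFlow N x) (hN : IsBalanced N) {v : E}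
    (h0 : ∀ i, 0 < inner ℝ v (x 0 i)) {i j : ι} (hj : j ∈ N i) :
    Tendsto (fun t => inner ℝ (x t i) (x t j)) atTop (𝓝 1) := by
  obtain ⟨k, -, hk⟩ := Finset.exists_min_image Finset.univ (fun i => inner ℝ v (x 0 i)) ⟨i, by simp⟩
  have hmin : ∀ t, 0 ≤ t → ∀ i, inner ℝ v (x 0 k) ≤ inner ℝ v (x t i) := fun t ht i =>
    hx.le_inner_of_le_inner_zero hN (h0 k).le (fun i => hk i (Finset.mem_univ i)) ht i
  set m := inner ℝ v (x 0 k)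
  suffices Tendsto (fun t => 1 - inner ℝ (x t i) (x t j)) atTop (𝓝 0) by
    simpa using this.const_sub 1
  refine tendsto_zero_of_mul_le_deriv (S := fun t => ∑ i, inner ℝ v (x t i))
    (B := Fintype.card ι * ‖v‖) (C := 2 * (Fintype.card ι * 2)) (h0 k)
    (fun t ht => HasDerivWithinAt.fun_sum fun i _ => hx.hasDerivWithinAt_inner v ht i)
    (fun t ht => ((hx.hasDerivWithinAt t ht i).inner ℝ (hx.hasDerivWithinAt t ht j)).const_sub 1)
    (fun t ht => ?_) (fun t _ => sub_nonneg.2 (hx.inner_le_one t i j)) (fun t _ => ?_)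
    (fun t _ => ?_)
  · have hnn : ∀ i j, 0 ≤ m * (1 - inner ℝ (x t i) (x t j)) := fun i j =>
      mul_nonneg (h0 k).le (sub_nonneg.2 (hx.inner_le_one t i j))
    calc m * (1 - inner ℝ (x t i) (x t j))
        ≤ ∑ j ∈ N i, m * (1 - inner ℝ (x t i) (x t j)) :=
          Finset.single_le_sum (f := fun j => m * (1 - inner ℝ (x t i) (x t j)))
            (fun j _ => hnn i j) hj
      _ ≤ ∑ i, ∑ j ∈ N i, m * (1 - inner ℝ (x t i) (x t j)) :=
          Finset.single_le_sum (f := fun i => ∑ j ∈ N i, m * (1 - inner ℝ (x t i) (x t j)))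
            (fun i _ => Finset.sum_nonneg fun j _ => hnn i j) (Finset.mem_univ i)
      _ ≤ ∑ i, ∑ j ∈ N i, inner ℝ v (x t i) * (1 - inner ℝ (x t i) (x t j)) :=
          Finset.sum_le_sum fun i _ => Finset.sum_le_sum fun j _ =>
            mul_le_mul_of_nonneg_right (hmin t ht i) (sub_nonneg.2 (hx.inner_le_one t i j))
      _ = _ := by
          -- Balance trades the neighbors' heights `⟪v, x j⟫` for the agents' own `⟪v, x i⟫`.
          simp_rw [Finset.sum_sub_distrib]
          rw [hN fun j => inner ℝ v (x t j)]
          simp_rw [← Finset.sum_sub_distrib]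
          refine Finset.sum_congr rfl fun i _ => Finset.sum_congr rfl fun j _ => by ring
  · calc ∑ i, inner ℝ v (x t i) ≤ ∑ _i : ι, ‖v‖ := Finset.sum_le_sum fun i _ => by
          simpa [hx.norm_eq_one] using real_inner_le_norm v (x t i)
      _ = _ := by simp
  · have h1 := (real_inner_le_norm (x t i) _).trans
      (mul_le_mul_of_nonneg_left (hx.norm_velocity_le t j) (norm_nonneg (x t i)))
    have h2 := (real_inner_le_norm _ (x t j)).trans
      (mul_le_mul_of_nonneg_right (hx.norm_velocity_le t i) (norm_nonneg (x t j)))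
    rw [hx.norm_eq_one] at h1 h2
    linarith

end IsConsensusFlow

end Consensus

/-! ### The closed-loop vector field -/

theorem cross_cross_self (a b : E3) :
    cross (cross a b) a = inner ℝ a a • b - inner ℝ a b • a := by
  ext i
  have h := congrFun (cross_cross_eq_smul_sub_smul a.ofLp b.ofLp a.ofLp) i
  simpa [cross, EuclideanSpace.inner_eq_star_dotProduct,
    -inner_self_eq_norm_sq_to_K] using h

theorem cross_neg_sum {ι : Type*} (s : Finset ι) (f : ι → E3) (a : E3) :
    cross (-∑ j ∈ s, f j) a = -∑ j ∈ s, cross (f j) a := by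
  ext i
  simp [cross, WithLp.ofLp_sum, map_sum, LinearMap.sum_apply]

/-- Keeping `⟪a, a⟫` instead of `1` makes each summand orthogonal to `a` even off the sphere;
`inner_rescaledField` relies on this. -/
theorem cross_neg_sum_cross {ι : Type*} (s : Finset ι) (b : ι → E3) (a : E3) :
    cross (-∑ j ∈ s, cross a (b j)) a =
      ∑ j ∈ s, (inner ℝ a (b j) • a - inner ℝ a a • b j) := by
  rw [cross_neg_sum, ← Finset.sum_neg_distrib]
  refine Finset.sum_congr rfl fun j _ => ?_
  rw [cross_cross_self, neg_sub]

/-- A smooth map of Euclidean space into the unit ball that rescales every vector and fixes the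
unit sphere. -/
noncomputable def rescale (x : E3) : E3 := (2 / (1 + ‖x‖ ^ 2)) • x

theorem rescale_of_norm_eq_one {x : E3} (hx : ‖x‖ = 1) : rescale x = x := by
  norm_num [rescale, hx]

theorem norm_rescale_le_one (x : E3) : ‖rescale x‖ ≤ 1 := by
  have h : 0 < 1 + ‖x‖ ^ 2 := by positivity
  rw [rescale, norm_smul, Real.norm_eq_abs, abs_of_pos (by positivity), div_mul_eq_mul_div,
    div_le_one h]
  nlinarith [sq_nonneg (‖x‖ - 1)]

theorem contDiff_rescale : ContDiff ℝ 1 rescale := by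
  have h : ContDiff ℝ 1 fun x : E3 => 1 + ‖x‖ ^ 2 := contDiff_const.add (contDiff_norm_sq ℝ)
  exact (contDiff_const.div h fun x => by positivity).smul contDiff_id

/-- A bounded smooth extension of the closed-loop vector field. -/
noncomputable def rescaledField {n : ℕ} (N : Fin n → Finset (Fin n)) (y : Fin n → E3) :
    Fin n → E3 := fun i =>
  ∑ j ∈ N i, (inner ℝ (rescale (y i)) (rescale (y j)) • rescale (y i) -
    inner ℝ (rescale (y i)) (rescale (y i)) • rescale (y j))

theorem contDiff_rescaledField {n : ℕ} (N : Fin n → Finset (Fin n)) :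
    ContDiff ℝ 1 (rescaledField N) := by
  have h : ∀ i, ContDiff ℝ 1 fun y : Fin n → E3 => rescale (y i) := fun i =>
    contDiff_rescale.comp (contDiff_apply ℝ E3 i)
  exact contDiff_pi.2 fun i => ContDiff.sum fun j _ =>
    (((h i).inner ℝ (h j)).smul (h i)).sub (((h i).inner ℝ (h i)).smul (h j))

theorem norm_rescaledField_le {n : ℕ} (N : Fin n → Finset (Fin n)) (y : Fin n → E3) :
    ‖rescaledField N y‖ ≤ ((n * 2 : ℝ≥0) : ℝ) := by
  refine (pi_norm_le_iff_of_nonneg (NNReal.coe_nonneg _)).2 fun i => ?_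
  have hinner : ∀ i j, ‖(inner ℝ (rescale (y i)) (rescale (y j)) : ℝ)‖ ≤ 1 := fun i j =>
    (norm_inner_le_norm _ _).trans
      (mul_le_one₀ (norm_rescale_le_one _) (norm_nonneg _) (norm_rescale_le_one _))
  have hsmul : ∀ i j k, ‖(inner ℝ (rescale (y i)) (rescale (y j)) : ℝ) • rescale (y k)‖ ≤ 1 := by
    intro i j k
    rw [norm_smul]
    exact mul_le_one₀ (hinner i j) (norm_nonneg _) (norm_rescale_le_one _)
  calc _ ≤ ∑ _j ∈ N i, (2 : ℝ) := norm_sum_le_of_le _ fun j _ =>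
        (norm_sub_le _ _).trans (by linarith [hsmul i j i, hsmul i i j])
    _ = (N i).card * 2 := by simp
    _ ≤ n * 2 := by gcongr; simpa using Finset.card_le_univ (N i)
    _ = _ := by simp

/-- `y i` is a multiple of `rescale (y i)`, to which each summand is orthogonal. Solutions of the
extended system therefore keep their norms and stay on the spheres. -/
theorem inner_rescaledField {n : ℕ} (N : Fin n → Finset (Fin n)) (y : Fin n → E3) (i : Fin n) :
    inner ℝ (y i) (rescaledField N y i) = 0 := by
  have h : 0 < 1 + ‖y i‖ ^ 2 := by positivity
  have hy : y i = ((1 + ‖y i‖ ^ 2) / 2) • rescale (y i) := by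
    rw [rescale, smul_smul, div_mul_div_comm, mul_comm, div_self (by positivity), one_smul]
  rw [hy, inner_smul_left, rescaledField, inner_sum]
  refine mul_eq_zero_of_right _ (Finset.sum_eq_zero fun j _ => ?_)
  rw [inner_sub_right, inner_smul_right, inner_smul_right]
  ring

/-- Every initial state is the origin of a trajectory for all nonnegative times. -/
theorem exists_isTrajectory {n : ℕ} (G : Digraph (Fin n)) (Γ₀ : State n) :
    ∃ Γ, IsTrajectory G Γ ∧ Γ 0 = Γ₀ := by
  obtain ⟨α, hα0, hα⟩ := exists_forward_solution (contDiff_rescaledField (neighbors G))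
    (norm_rescaledField_le _) (fun i => (Γ₀ i : E3))
  have hαi : ∀ t, 0 ≤ t → ∀ i, HasDerivWithinAt (fun s => α s i)
      (rescaledField (neighbors G) (α t) i) (Ici 0) t := fun t ht =>
    hasDerivWithinAt_pi.1 (hα t ht)
  have hnorm : ∀ t, 0 ≤ t → ∀ i, ‖α t i‖ = 1 := by
    intro t ht i
    have hd : ∀ s, 0 ≤ s → HasDerivWithinAt (fun s => ‖α s i‖ ^ 2) 0 (Ici 0) s := by
      intro s hs
      simpa [inner_rescaledField] using (hαi s hs i).norm_sq
    have h1 := monotoneOn_Ici_of_hasDerivWithinAt hd (fun _ _ => le_rfl)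
      (mem_Ici.2 le_rfl) (mem_Ici.2 ht) ht
    have h2 := monotoneOn_Ici_of_hasDerivWithinAt (fun s hs => (hd s hs).neg)
      (fun _ _ => by simp) (mem_Ici.2 le_rfl) (mem_Ici.2 ht) ht
    simp only [hα0, norm_eq_of_mem_sphere, Pi.neg_apply] at h1 h2
    exact (pow_eq_one_iff_of_nonneg (norm_nonneg _) two_ne_zero).1 (by linarith)
  -- Negative times also need values on the sphere, so the curve is frozen there.
  refine ⟨fun t i => ⟨α (max t 0) i, by simpa using hnorm _ (le_max_right _ _) i⟩, ?_, ?_⟩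
  · intro t ht i
    refine HasDerivWithinAt.congr (f := fun s => α s i) ?_ (fun s hs => ?_) ?_
    · convert! hαi t ht i using 1
      simp only [control, cross_neg_sum_cross, rescaledField, max_eq_left ht,
        rescale_of_norm_eq_one (hnorm t ht _)]
    · simp only [max_eq_left (mem_Ici.1 hs)]
    · simp only [max_eq_left ht]
  · funext i
    ext1
    simp [hα0]

/-! ### Rings -/

section Ring

variable {n : ℕ} [NeZero n]

/-- Evenness matters only at the wrap-around from `n - 1` to `0`. -/
theorem neg_one_pow_fin_add_one (heven : Even n) (i : Fin n) :
    (-1 : ℝ) ^ ((i + 1 : Fin n) : ℕ) = -(-1) ^ (i : ℕ) := by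
  have hpow : -(-1 : ℝ) ^ (i : ℕ) = (-1) ^ ((i : ℕ) + 1) := by rw [pow_succ]; ring
  rw [Fin.val_add, Fin.val_one', Nat.add_mod_mod, hpow]
  rcases Nat.lt_or_ge ((i : ℕ) + 1) n with h | h
  · rw [Nat.mod_eq_of_lt h]
  · have h' : (i : ℕ) + 1 = n := le_antisymm i.2 h
    rw [h', Nat.mod_self, pow_zero, heven.neg_one_pow]

/-- In either ring, the neighbors of an agent are its successor or its two distinct adjacent
agents. -/
theorem neighbors_ring (G : Digraph (Fin n)) (hG : IsUndirectedRing G ∨ IsDirectedRing G) :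
    (∀ i, neighbors G i = {i + 1}) ∨
      ∀ i, neighbors G i = {i - 1, i + 1} ∧ i - 1 ≠ i + 1 := by
  rcases hG with h | h
  · by_cases h1 : (1 : Fin n) + 1 = 0
    · left
      intro i
      have : i - 1 = i + 1 := by rw [sub_eq_iff_eq_add, add_assoc, h1, add_zero]
      rw [h i, this, Finset.pair_eq_singleton]
    · right
      refine fun i => ⟨h i, fun hi => h1 ?_⟩
      rwa [sub_eq_iff_eq_add, add_assoc, left_eq_add] at hi
  · exact Or.inl h

/-- The shifts `i ± 1` permute the agents. -/
theorem isBalanced_neighbors {G : Digraph (Fin n)} (hG : IsUndirectedRing G ∨ IsDirectedRing G) :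
    IsBalanced (neighbors G) := by
  intro f
  have h1 : ∑ i : Fin n, f (i + 1) = ∑ i, f i := Equiv.sum_comp (Equiv.addRight (1 : Fin n)) f
  have h2 : ∑ i : Fin n, f (i - 1) = ∑ i, f i := Equiv.sum_comp (Equiv.subRight (1 : Fin n)) f
  rcases neighbors_ring G hG with h | h
  · simp [h, h1]
  · calc ∑ i, ∑ j ∈ neighbors G i, f j = ∑ i, (f (i - 1) + f (i + 1)) :=
          Finset.sum_congr rfl fun i _ => by rw [(h i).1, Finset.sum_pair (h i).2]
      _ = ∑ i, (f i + f i) := by rw [Finset.sum_add_distrib, h1, h2, Finset.sum_add_distrib]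
      _ = _ := Finset.sum_congr rfl fun i _ => by rw [(h i).1, Finset.sum_pair (h i).2]

theorem add_one_mem_neighbors {G : Digraph (Fin n)}
    (hG : IsUndirectedRing G ∨ IsDirectedRing G) (i : Fin n) : i + 1 ∈ neighbors G i := by
  rcases hG with h | h <;> simp [h i]

theorem neg_one_pow_of_mem_neighbors (heven : Even n) {G : Digraph (Fin n)}
    (hG : IsUndirectedRing G ∨ IsDirectedRing G) {i j : Fin n} (hj : j ∈ neighbors G i) :
    (-1 : ℝ) ^ (j : ℕ) = -(-1) ^ (i : ℕ) := by
  have hj' : j = i - 1 ∨ j = i + 1 := by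
    rcases hG with h | h <;> rw [h i] at hj <;> simp at hj <;> tauto
  rcases hj' with rfl | rfl
  · have := neg_one_pow_fin_add_one heven (i - 1)
    rw [sub_add_cancel] at this
    rw [this, neg_neg]
  · exact neg_one_pow_fin_add_one heven i

end Ring

/-! ### Alternating signs -/

section Alternate

variable {n : ℕ}

/-- The components of a state with alternating signs; antipodal formations become consensus. -/
noncomputable def alternate (Γ : State n) (i : Fin n) : E3 := (-1 : ℝ) ^ (i : ℕ) • (Γ i : E3)

theorem norm_alternate (Γ : State n) (i : Fin n) : ‖alternate Γ i‖ = 1 := by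
  simp [alternate, norm_smul]

theorem neg_one_pow_smul_alternate (Γ : State n) (i : Fin n) :
    (-1 : ℝ) ^ (i : ℕ) • alternate Γ i = Γ i := by
  rw [alternate, smul_smul, ← mul_pow]
  simp

/-- Neighbors carry opposite signs, so `(-1)^i (-1)^j = -1` turns the repulsion into attraction. -/
theorem isConsensusFlow_alternate [NeZero n] (heven : Even n) {G : Digraph (Fin n)}
    (hG : IsUndirectedRing G ∨ IsDirectedRing G) {Γ : ℝ → State n} (hΓ : IsTrajectory G Γ) :
    IsConsensusFlow (neighbors G) fun t => alternate (Γ t) where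
  norm_eq_one t i := norm_alternate _ i
  hasDerivWithinAt t ht i := by
    have h := (hΓ t ht i).const_smul ((-1 : ℝ) ^ (i : ℕ))
    convert! h using 1
    rw [control, cross_neg_sum_cross, Finset.smul_sum]
    refine Finset.sum_congr rfl fun j hj => ?_
    have hs : (-1 : ℝ) ^ (i : ℕ) * (-1) ^ (i : ℕ) = 1 := by rw [← mul_pow]; simp
    rw [alternate, alternate, neg_one_pow_of_mem_neighbors heven hG hj, real_inner_smul_left,
      real_inner_smul_right, real_inner_self_eq_norm_sq, norm_eq_of_mem_sphere,
      show ∀ s c : ℝ, s * (-s * c) = -(s * s) * c by intros; ring, hs]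
    module

/-- The antipodal formation with a given axis. -/
noncomputable def antipodalState (n : ℕ) (v : S2) : State n := fun i =>
  ⟨(-1 : ℝ) ^ (i : ℕ) • (v : E3), by simp [norm_smul]⟩

theorem antipodalState_mem (v : S2) : antipodalState n v ∈ antipodalSet n := ⟨v, fun _ => rfl⟩

theorem mem_antipodalSet_iff (Γ : State n) :
    Γ ∈ antipodalSet n ↔ ∃ v : S2, ∀ i, alternate Γ i = v := by
  refine exists_congr fun v => forall_congr' fun i => ⟨fun h => ?_, fun h => ?_⟩
  · rw [alternate, h, smul_smul, ← mul_pow]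
    simp
  · rw [← neg_one_pow_smul_alternate, h]

open InnerProductGeometry

theorem geodDist_nonneg (x y : S2) : 0 ≤ geodDist x y := Real.arccos_nonneg _

theorem angle_eq_arccos {x y : E3} (hx : ‖x‖ = 1) (hy : ‖y‖ = 1) :
    angle x y = Real.arccos (inner ℝ x y) := by
  simp [angle, hx, hy]

/-- Applying one sign to both points preserves their distance. -/
theorem geodDist_eq_angle_alternate {Γ Γ' : State n} {v : E3} {i : Fin n}
    (h : (Γ' i : E3) = (-1 : ℝ) ^ (i : ℕ) • v) (hv : ‖v‖ = 1) :
    geodDist (Γ i) (Γ' i) = angle v (alternate Γ i) := by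
  rw [geodDist, h, angle_eq_arccos hv (norm_alternate _ _), real_inner_comm, alternate,
    inner_smul_left, inner_smul_right]
  simp

theorem stateDist_nonneg (Γ Γ' : State n) : 0 ≤ stateDist Γ Γ' :=
  Real.iSup_nonneg fun _ => geodDist_nonneg _ _

theorem distToSet_nonneg (M : Set (State n)) (Γ : State n) : 0 ≤ distToSet M Γ :=
  Real.sInf_nonneg (by rintro _ ⟨Γ', -, rfl⟩; exact stateDist_nonneg _ _)

theorem distToSet_antipodalSet_le {Γ : State n} {v : E3} (hv : ‖v‖ = 1) {r : ℝ} (hr : 0 ≤ r)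
    (h : ∀ i, angle v (alternate Γ i) ≤ r) : distToSet (antipodalSet n) Γ ≤ r := by
  refine (csInf_le ⟨0, ?_⟩ (mem_image_of_mem _
    (antipodalState_mem ⟨v, by simpa using hv⟩))).trans ?_
  · rintro _ ⟨Γ', -, rfl⟩
    exact stateDist_nonneg _ _
  · exact Real.iSup_le (fun i => (geodDist_eq_angle_alternate rfl hv).trans_le (h i)) hr

theorem exists_angle_le_of_distToSet_lt [NeZero n] {Γ : State n} {δ : ℝ}
    (h : distToSet (antipodalSet n) Γ < δ) :
    ∃ v : E3, ‖v‖ = 1 ∧ ∃ r < δ, 0 ≤ r ∧ ∀ i, angle v (alternate Γ i) ≤ r := by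
  obtain ⟨_, ⟨Γ', ⟨v, hv⟩, rfl⟩, hlt⟩ := exists_lt_of_csInf_lt
    (Set.Nonempty.image (stateDist Γ) ⟨_, antipodalState_mem (n := n) (Γ 0)⟩) h
  refine ⟨v, norm_eq_of_mem_sphere v, _, hlt, stateDist_nonneg _ _, fun i => ?_⟩
  rw [← geodDist_eq_angle_alternate (Γ := Γ) (hv i) (norm_eq_of_mem_sphere v)]
  exact le_ciSup (f := fun i => geodDist (Γ i) (Γ' i)) (Set.finite_range _).bddAbove i

/-! ### Short closed polygons on the sphere -/

/-- Otherwise `⟪b, c⟫ ≤ -⟪a, b⟫`, and the angle at `b, c` is at least `π` minus that at `a, b`. -/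
theorem inner_add_pos_of_angle_add_lt_pi {a b c : E3} (ha : ‖a‖ = 1) (hb : ‖b‖ = 1)
    (hc : ‖c‖ = 1) (h : angle a b + angle b c < Real.pi) : 0 < inner ℝ (a + c) b := by
  rw [inner_add_left]
  by_contra! hle
  have h1 : Real.arccos (-inner ℝ b c) ≤ Real.arccos (inner ℝ a b) :=
    Real.arccos_le_arccos (by linarith [real_inner_comm c b])
  rw [Real.arccos_neg, ← angle_eq_arccos ha hb, ← angle_eq_arccos hb hc] at h1
  linarith

theorem angle_le_mul {y : ℕ → E3} (hy : ∀ k, ‖y k‖ = 1) {c : ℝ}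
    (hc : ∀ k, angle (y k) (y (k + 1)) < c) (a k : ℕ) : angle (y a) (y (a + k)) ≤ k * c := by
  induction k with
  | zero =>
    have h0 : y a ≠ 0 := fun h => by simpa [h] using hy a
    simp [angle_self h0]
  | succ k ih =>
    have h1 := angle_le_angle_add_angle (y a) (y (a + k)) (y (a + k + 1))
    have h2 := hc (a + k)
    rw [← add_assoc]
    push_cast
    linarith

theorem angle_lt_mul {y : ℕ → E3} (hy : ∀ k, ‖y k‖ = 1) {c : ℝ}
    (hc : ∀ k, angle (y k) (y (k + 1)) < c) {a b : ℕ} (hab : a < b) :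
    angle (y a) (y b) < ((b : ℝ) - a) * c := by
  obtain ⟨k, rfl⟩ := Nat.exists_eq_add_of_lt hab
  have h1 := angle_le_angle_add_angle (y a) (y (a + k)) (y (a + k + 1))
  have h2 := hc (a + k)
  have h3 := angle_le_mul hy hc a k
  push_cast
  linarith

/-- A closed spherical polygon with an even number of sides, each shorter than `2π/n`, lies in
an open hemisphere. -/
theorem exists_inner_pos_of_angle_lt {y : ℕ → E3} (hy : ∀ k, ‖y k‖ = 1) (hn : 2 ≤ n)
    (heven : Even n) (hyn : y n = y 0)
    (hc : ∀ k, angle (y k) (y (k + 1)) < 2 * Real.pi / n) :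
    ∃ v : E3, ∀ k < n, 0 < inner ℝ v (y k) := by
  obtain ⟨h, rfl⟩ := heven
  have hh : (0 : ℝ) < h := by
    have : 0 < h := by omega
    exact_mod_cast this
  have hpi : (h : ℝ) * (2 * Real.pi / ((h + h : ℕ) : ℝ)) = Real.pi := by
    push_cast
    field_simp
    ring
  set c := 2 * Real.pi / ((h + h : ℕ) : ℝ)
  -- The opposite vertices `y 0` and `y h` split the polygon into two chains of `h` sides, each
  -- shorter than `h c = π`; every vertex lies on one of them.
  refine ⟨y 0 + y h, fun k hk => ?_⟩
  rcases Nat.lt_or_ge k h with hkh | hkh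
  · have h1 := angle_le_mul hy hc 0 k
    have h2 := angle_lt_mul hy hc hkh
    rw [zero_add] at h1
    exact inner_add_pos_of_angle_add_lt_pi (hy _) (hy _) (hy _) (by linarith)
  · obtain ⟨l, rfl⟩ := Nat.exists_eq_add_of_le hkh
    have h1 := angle_le_mul hy hc h l
    have h2 := angle_lt_mul hy hc hk
    rw [hyn] at h2
    push_cast at h2
    rw [add_comm]
    exact inner_add_pos_of_angle_add_lt_pi (hy _) (hy _) (hy _) (by linarith)

theorem exists_inner_alternate_pos [NeZero n] (hn : 2 ≤ n) (heven : Even n) {Γ : State n}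
    (h : minNeighborDist Γ > Real.pi - 2 * Real.pi / n) :
    ∃ v : E3, ∀ i, 0 < inner ℝ v (alternate Γ i) := by
  have hstep : ∀ i : Fin n, angle (alternate Γ i) (alternate Γ (i + 1)) < 2 * Real.pi / n := by
    intro i
    have h1 : minNeighborDist Γ ≤ geodDist (Γ i) (Γ (i + 1)) :=
      ciInf_le (f := fun i => geodDist (Γ i) (Γ (i + 1))) (Set.finite_range _).bddBelow i
    have hs : (-1 : ℝ) ^ (i : ℕ) * (-1) ^ (i : ℕ) = 1 := by rw [← mul_pow]; simp
    have h2 : inner ℝ (alternate Γ i) (alternate Γ (i + 1)) =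
        -inner ℝ (Γ i : E3) (Γ (i + 1) : E3) := by
      rw [alternate, alternate, neg_one_pow_fin_add_one heven, real_inner_smul_left,
        real_inner_smul_right, ← mul_assoc, mul_neg, hs, neg_one_mul]
    rw [angle_eq_arccos (norm_alternate _ _) (norm_alternate _ _), h2, Real.arccos_neg]
    rw [geodDist] at h1
    linarith
  -- The ring is unrolled into an `n`-periodic sequence.
  obtain ⟨v, hv⟩ := exists_inner_pos_of_angle_lt (y := fun k => alternate Γ (Fin.ofNat n k))
    (fun k => norm_alternate _ _) hn heven
    (by congr 1; ext; simp)
    (fun k => by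
      have : Fin.ofNat n (k + 1) = Fin.ofNat n k + 1 := by ext; simp [Fin.val_add]
      simp only [this]
      exact hstep _)
  refine ⟨v, fun i => ?_⟩
  have : Fin.ofNat n (i : ℕ) = i := by ext; simp
  simpa only [this] using hv i i.2

/-! ### Attraction -/

/-- States whose alternated components lie in an open hemisphere are attracted to the antipodal
formations. -/
theorem mem_regionOfAttraction_of_inner_pos [NeZero n] (heven : Even n) {G : Digraph (Fin n)}
    (hG : IsUndirectedRing G ∨ IsDirectedRing G) {Γ₀ : State n} {v : E3}
    (hv : ∀ i, 0 < inner ℝ v (alternate Γ₀ i)) :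
    Γ₀ ∈ regionOfAttraction G (antipodalSet n) := by
  refine ⟨exists_isTrajectory G Γ₀, fun Γ hΓ hΓ0 => ?_⟩
  subst hΓ0
  have hx := isConsensusFlow_alternate heven hG hΓ
  have hstep : ∀ i : Fin n, Tendsto (fun t => angle (alternate (Γ t) i) (alternate (Γ t) (i + 1)))
      atTop (𝓝 0) := by
    intro i
    have h := (Real.continuous_arccos.tendsto 1).comp
      (hx.tendsto_inner_neighbor (isBalanced_neighbors hG) hv (add_one_mem_neighbors hG i))
    rw [Real.arccos_one] at h
    refine h.congr fun t => ?_
    rw [angle_eq_arccos (norm_alternate _ _) (norm_alternate _ _)]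
    rfl
  have hall : ∀ k : ℕ, Tendsto
      (fun t => angle (alternate (Γ t) 0) (alternate (Γ t) (Fin.ofNat n k))) atTop (𝓝 0) := by
    intro k
    induction k with
    | zero =>
      refine tendsto_const_nhds.congr fun t => ?_
      have h0 : alternate (Γ t) 0 ≠ 0 := fun h => by simpa [h] using norm_alternate (Γ t) 0
      exact (angle_self h0).symm
    | succ k ih =>
      have : Fin.ofNat n (k + 1) = Fin.ofNat n k + 1 := by ext; simp [Fin.val_add]
      rw [this]
      have hadd := ih.add (hstep (Fin.ofNat n k))
      rw [add_zero] at hadd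
      exact squeeze_zero (fun t => angle_nonneg _ _)
        (fun t => angle_le_angle_add_angle _ (alternate (Γ t) (Fin.ofNat n k)) _) hadd
  have hsum : Tendsto (fun t => ∑ i : Fin n, angle (alternate (Γ t) 0) (alternate (Γ t) i))
      atTop (𝓝 0) := by
    rw [show (0 : ℝ) = ∑ _i : Fin n, 0 by simp]
    refine tendsto_finsetSum (Finset.univ : Finset (Fin n)) fun i _ => ?_
    have : Fin.ofNat n (i : ℕ) = i := by ext; simp
    simpa only [this] using hall i
  -- The comparison formation has the moving axis `alternate (Γ t) 0`; the sum of angles bounds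
  -- their maximum.
  refine squeeze_zero (fun t => distToSet_nonneg _ _) (fun t => ?_) hsum
  exact distToSet_antipodalSet_le (norm_alternate _ _)
    (Finset.sum_nonneg fun i _ => angle_nonneg _ _)
    fun i => Finset.single_le_sum (f := fun i => angle (alternate (Γ t) 0) (alternate (Γ t) i))
      (fun i _ => angle_nonneg _ _) (Finset.mem_univ i)

theorem isPositivelyInvariant_antipodalSet [NeZero n] (heven : Even n) {G : Digraph (Fin n)}
    (hG : IsUndirectedRing G ∨ IsDirectedRing G) :
    IsPositivelyInvariant G (antipodalSet n) := by
  intro Γ hΓ h0 t ht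
  rw [mem_antipodalSet_iff] at h0 ⊢
  obtain ⟨v, hv⟩ := h0
  have hx := isConsensusFlow_alternate heven hG hΓ
  refine ⟨v, fun i => ?_⟩
  -- The cap of height `1` is the single point `v`.
  have h := hx.le_inner_of_le_inner_zero (isBalanced_neighbors hG) (v := (v : E3)) zero_le_one
    (fun i => by rw [hv i, real_inner_self_eq_norm_sq]; simp) ht i
  have h' := real_inner_le_norm (v : E3) (alternate (Γ t) i)
  rw [norm_alternate, norm_eq_of_mem_sphere, one_mul] at h'
  exact ((inner_eq_one_iff_of_norm_eq_one (norm_eq_of_mem_sphere v) (norm_alternate _ _)).1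
    (le_antisymm h' h)).symm

theorem isStableSet_antipodalSet [NeZero n] (heven : Even n) {G : Digraph (Fin n)}
    (hG : IsUndirectedRing G ∨ IsDirectedRing G) : IsStableSet G (antipodalSet n) := by
  intro ε hε
  -- Radii `r ≤ π / 2` give `cos r ≥ 0`, so the cap of radius `r` is invariant.
  refine ⟨min ε (Real.pi / 2), lt_min hε (by positivity), fun Γ hΓ h0 t ht => ?_⟩
  obtain ⟨v, hv, r, hr, hr0, hle⟩ := exists_angle_le_of_distToSet_lt h0
  have hx := isConsensusFlow_alternate heven hG hΓ
  have hrpi : r ≤ Real.pi / 2 := (hr.trans_le (min_le_right _ _)).le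
  refine (distToSet_antipodalSet_le hv hr0 fun i => ?_).trans_lt (hr.trans_le (min_le_left _ _))
  have hinner : Real.cos r ≤ inner ℝ v (alternate (Γ t) i) := by
    refine hx.le_inner_of_le_inner_zero (isBalanced_neighbors hG)
      (Real.cos_nonneg_of_neg_pi_div_two_le_of_le (by linarith [Real.pi_pos]) hrpi)
      (fun i => ?_) ht i
    have h := Real.cos_le_cos_of_nonneg_of_le_pi (angle_nonneg _ _) (by linarith [Real.pi_pos])
      (hle i)
    rwa [cos_angle, hv, norm_alternate, one_mul, div_one] at h
  rw [angle_eq_arccos hv (norm_alternate _ _)]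
  calc _ ≤ Real.arccos (Real.cos r) := Real.arccos_le_arccos hinner
    _ = r := Real.arccos_cos hr0 (by linarith [Real.pi_pos])

end Alternate

end ReducedAttitude

open ReducedAttitude
theorem mainTheorem1 (n : ℕ) [NeZero n] (hn : 2 ≤ n) (heven : Even n) (G : Digraph (Fin n))
    (hG : IsUndirectedRing G ∨ IsDirectedRing G) :
    IsPositivelyInvariant G (antipodalSet n) ∧
    IsAsymptoticallyStableSet G (antipodalSet n) ∧
    {Γ : State n | minNeighborDist Γ > Real.pi - 2 * Real.pi / n} ⊆
      regionOfAttraction G (antipodalSet n) := by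
  refine ⟨isPositivelyInvariant_antipodalSet heven hG,
    ⟨isStableSet_antipodalSet heven hG, Real.pi / 2, by positivity, fun Γ₀ h => ?_⟩,
    fun Γ₀ h => ?_⟩
  -- Within distance `π / 2` of an antipodal formation, the alternated agents lie in the open
  -- hemisphere about its axis.
  · obtain ⟨v, hv, r, hr, -, hle⟩ := exists_angle_le_of_distToSet_lt h
    refine mem_regionOfAttraction_of_inner_pos heven hG (v := v) fun i => ?_
    have := (hle i).trans_lt hr
    rwa [angle_eq_arccos hv (norm_alternate _ _), Real.arccos_lt_pi_div_two] at this
  · obtain ⟨v, hv⟩ := exists_inner_alternate_pos hn heven h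
    exact mem_regionOfAttraction_of_inner_pos heven hG hv
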